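/- Let $\mathbb{T}\subset\mathbb{R}$ be a time scale (a nonempty closed set) with $a=\min\mathbb{T}$, $b=\max\mathbb{T}$, $a<b$ and $\mathbb{T}\cap(a,b)\neq\emptyset$; put $I=\mathbb{T}$, $I^\kappa=I\setminus(\rho(b),b]$ and $I_\kappa=I\setminus[a,\sigma(a))$, where $\sigma,\rho$ are the forward and backward jump operators of $\mathbb{T}$, and write $y^\sigma=y\circ\sigma$, $y^\rho=y\circ\rho$. Let $C^1_\diamond$ be the class of functions $y:I\to\mathbb{R}$ that are delta differentiable on $I^\kappa$ with $y^\Delta$ continuous on $I^\kappa$, and nabla differentiable on $I_\kappa$ with $y^\nabla$ continuous on $I_\kappa$. Let $L_\Delta,L_\nabla:\mathbb{T}\times\mathbb{R}^2\to\mathbb{R}$ be continuous and such that their partial derivatives $\partial_2,\partial_3$ with respect to the second and third variables exist and are continuous on $\mathbb{T}\times\mathbb{R}^2$. Let $\alpha,\beta\in\mathbb{R}$ and $\gamma_1,\gamma_2\ge 0$. Write $[y](t)=(t,y^\sigma(t),y^\Delta(t))$ and $\{y\}(t)=(t,y^\rho(t),y^\nabla(t))$. Consider the functional $$\mathcal{L}(y)=\gamma_1\int_a^b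 L_\Delta[y](t)\,\Delta t+\gamma_2\int_a^b L_\nabla\{y\}(t)\,\nabla t$$ on the set of admissible functions, i.e. of those $y\in C^1_\diamond$ with $y(a)=\alpha$, $y(b)=\beta$. Let $\hat y$ be admissible and suppose that, for some constant $c$, at least one of the following two equations holds: $$\gamma_1\Big(\partial_3L_\Delta[\hat y](\rho(t))-\int_a^{\rho(t)}\partial_2L_\Delta[\hat y](\tau)\,\Delta\tau\Big)+\gamma_2\Big(\partial_3L_\nabla\{\hat y\}(t)-\int_a^{t}\partial_2L_\nabla\{\hat y\}(\tau)\,\nabla\tau\Big)=c\quad\text{for all }t\in I_\kappa,$$ $$\gamma_1\Big(\partial_3L_\Delta[\hat y](t)-\int_a^{t}\partial_2L_\Delta[\hat y](\tau)\,\Delta\tau\Big)+\gamma_2\Big(\partial_3L_\nabla\{\hat y\}(\sigma(t))-\int_a^{\sigma(t)}\partial_2L_\nabla\{\hat y\}(\tau)\,\nabla\tau\Big)=c\quad\text{for all }t\in I^\kappa.$$ If, for every $t\in I$, $L_\Delta(t,\cdot,\cdot)$ and $L_\nabla(t,\cdot,\cdot)$ are jointly convex on $\mathbb{R}^2$, then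 $\mathcal{L}(\hat y)\le\mathcal{L}(y)$ for every admissible $y$, so $\hat y$ is a global minimizer. If, for every $t\in I$, they are jointly concave, then $\mathcal{L}(\hat y)\ge\mathcal{L}(y)$ for every admissible $y$, so $\hat y$ is a global maximizer. -/

import Mathlib

open Set MeasureTheory
open scoped Topology

noncomputable section

namespace TimeScale

/-! Calculus on a compact time scale `T` (a closed set of reals having a least element `a = sInf T`
and a greatest element `b = sSup T`). A function on `T` is represented by a function `ℝ → ℝ` of
which only the values on `T` are used. -/

/-- Forward jump operator `σ(t) = inf {s ∈ T : s > t}`, with the convention `inf ∅ = sup T`. -/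
def sigma (T : Set ℝ) (t : ℝ) : ℝ :=
  open Classical in if (T ∩ Ioi t).Nonempty then sInf (T ∩ Ioi t) else sSup T

/-- Backward jump operator `ρ(t) = sup {s ∈ T : s < t}`, with the convention `sup ∅ = inf T`. -/
def rho (T : Set ℝ) (t : ℝ) : ℝ :=
  open Classical in if (T ∩ Iio t).Nonempty then sSup (T ∩ Iio t) else sInf T

/-- `T^κ = T \ (ρ(b), b]`. -/
def upperKappa (T : Set ℝ) : Set ℝ := T \ Ioc (rho T (sSup T)) (sSup T)

/-- `T_κ = T \ [a, σ(a))`. -/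
def lowerKappa (T : Set ℝ) : Set ℝ := T \ Ico (sInf T) (sigma T (sInf T))

/-- `d` is a delta (Hilger) derivative of `f` at `t`; it is unique for `t ∈ T^κ`. -/
def HasDeltaDerivAt (T : Set ℝ) (f : ℝ → ℝ) (d t : ℝ) : Prop :=
  ∀ ε > 0, ∃ U ∈ 𝓝 t, ∀ s ∈ U ∩ T,
    |f (sigma T t) - f s - d * (sigma T t - s)| ≤ ε * |sigma T t - s|

/-- `d` is a nabla derivative of `f` at `t`; it is unique for `t ∈ T_κ`. -/
def HasNablaDerivAt (T : Set ℝ) (f : ℝ → ℝ) (d t : ℝ) : Prop :=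
  ∀ ε > 0, ∃ U ∈ 𝓝 t, ∀ s ∈ U ∩ T,
    |f (rho T t) - f s - d * (rho T t - s)| ≤ ε * |rho T t - s|

/-- The delta derivative `f^Δ(t)` (zero if there is none). -/
def deltaDeriv (T : Set ℝ) (f : ℝ → ℝ) (t : ℝ) : ℝ :=
  open Classical in if h : ∃ d, HasDeltaDerivAt T f d t then h.choose else 0

/-- The nabla derivative `f^∇(t)` (zero if there is none). -/
def nablaDeriv (T : Set ℝ) (f : ℝ → ℝ) (t : ℝ) : ℝ :=
  open Classical in if h : ∃ d, HasNablaDerivAt T f d t then h.choose else 0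

/-- The Lebesgue delta measure of `T`, i.e. the measure carried by `T ∩ [a, b)` which gives mass
`d - c` to `[c, d)` for all `c ≤ d` in `T`. It is the image of Lebesgue measure on `[a, b)` under
`t ↦ max {s ∈ T : s ≤ t}`, a map under which the preimage of `[c, d)` is `[c, d)`. -/
def deltaMeasure (T : Set ℝ) : Measure ℝ :=
  (volume.restrict (Ico (sInf T) (sSup T))).map (fun t => sSup (T ∩ Iic t))

/-- The Lebesgue nabla measure of `T`, i.e. the measure carried by `T ∩ (a, b]` which gives mass
`d - c` to `(c, d]` for all `c ≤ d` in `T`. It is the image of Lebesgue measure on `(a, b]` under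
`t ↦ min {s ∈ T : t ≤ s}`, a map under which the preimage of `(c, d]` is `(c, d]`. -/
def nablaMeasure (T : Set ℝ) : Measure ℝ :=
  (volume.restrict (Ioc (sInf T) (sSup T))).map (fun t => sInf (T ∩ Ici t))

/-- The delta integral `∫_r^s f(τ) Δτ` for `r ≤ s` in `T`. -/
def deltaIntegral (T : Set ℝ) (f : ℝ → ℝ) (r s : ℝ) : ℝ :=
  ∫ τ in Ico r s, f τ ∂(deltaMeasure T)

/-- The nabla integral `∫_r^s f(τ) ∇τ` for `r ≤ s` in `T`. -/
def nablaIntegral (T : Set ℝ) (f : ℝ → ℝ) (r s : ℝ) : ℝ :=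
  ∫ τ in Ioc r s, f τ ∂(nablaMeasure T)

/-- The class `C¹_◇`: `y` is delta differentiable on `T^κ` with `y^Δ` continuous there, and nabla
differentiable on `T_κ` with `y^∇` continuous there. -/
structure IsC1Diamond (T : Set ℝ) (y : ℝ → ℝ) : Prop where
  delta_differentiable : ∀ t ∈ upperKappa T, ∃ d, HasDeltaDerivAt T y d t
  delta_continuous : ContinuousOn (deltaDeriv T y) (upperKappa T)
  nabla_differentiable : ∀ t ∈ lowerKappa T, ∃ d, HasNablaDerivAt T y d t
  nabla_continuous : ContinuousOn (nablaDeriv T y) (lowerKappa T)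

/-- The partial derivative of `L` with respect to its second variable. -/
def partial2 (L : ℝ → ℝ → ℝ → ℝ) (t u v : ℝ) : ℝ := deriv (fun x => L t x v) u

/-- The partial derivative of `L` with respect to its third variable. -/
def partial3 (L : ℝ → ℝ → ℝ → ℝ) (t u v : ℝ) : ℝ := deriv (fun x => L t u x) v

/-- The regularity asked of a Lagrangian `L : T × ℝ² → ℝ`: it is continuous, and its partial
derivatives in the second and third variables exist and are continuous on `T × ℝ²`. -/
structure IsSmoothLagrangian (T : Set ℝ) (L : ℝ → ℝ → ℝ → ℝ) : Prop where
  continuous : ContinuousOn (fun p : ℝ × ℝ × ℝ => L p.1 p.2.1 p.2.2) (T ×ˢ univ)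
  differentiable2 : ∀ t ∈ T, ∀ u v : ℝ, DifferentiableAt ℝ (fun x => L t x v) u
  differentiable3 : ∀ t ∈ T, ∀ u v : ℝ, DifferentiableAt ℝ (fun x => L t u x) v
  continuous2 : ContinuousOn (fun p : ℝ × ℝ × ℝ => partial2 L p.1 p.2.1 p.2.2) (T ×ˢ univ)
  continuous3 : ContinuousOn (fun p : ℝ × ℝ × ℝ => partial3 L p.1 p.2.1 p.2.2) (T ×ˢ univ)

/-- `L` is jointly convex in its second and third arguments, for every `t ∈ T`. -/
def JointlyConvex (T : Set ℝ) (L : ℝ → ℝ → ℝ → ℝ) : Prop :=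
  ∀ t ∈ T, ConvexOn ℝ univ (fun p : ℝ × ℝ => L t p.1 p.2)

/-- `L` is jointly concave in its second and third arguments, for every `t ∈ T`. -/
def JointlyConcave (T : Set ℝ) (L : ℝ → ℝ → ℝ → ℝ) : Prop :=
  ∀ t ∈ T, ConcaveOn ℝ univ (fun p : ℝ × ℝ => L t p.1 p.2)

/-- `F[y](t) = F(t, y^σ(t), y^Δ(t))`. -/
def alongDelta (T : Set ℝ) (F : ℝ → ℝ → ℝ → ℝ) (y : ℝ → ℝ) (t : ℝ) : ℝ :=
  F t (y (sigma T t)) (deltaDeriv T y t)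

/-- `F{y}(t) = F(t, y^ρ(t), y^∇(t))`. -/
def alongNabla (T : Set ℝ) (F : ℝ → ℝ → ℝ → ℝ) (y : ℝ → ℝ) (t : ℝ) : ℝ :=
  F t (y (rho T t)) (nablaDeriv T y t)

/-- The functional `γ₁ ∫_a^b L_Δ[y](t) Δt + γ₂ ∫_a^b L_∇{y}(t) ∇t`. -/
def functional (T : Set ℝ) (a b γ₁ γ₂ : ℝ) (LΔ Lnabla : ℝ → ℝ → ℝ → ℝ) (y : ℝ → ℝ) : ℝ :=
  γ₁ * deltaIntegral T (alongDelta T LΔ y) a b +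
    γ₂ * nablaIntegral T (alongNabla T Lnabla y) a b

/-- Admissible functions: members of `C¹_◇` with the prescribed endpoint values. -/
def Admissible (T : Set ℝ) (a b α β : ℝ) (y : ℝ → ℝ) : Prop :=
  IsC1Diamond T y ∧ y a = α ∧ y b = β

/-- `∂₃L_Δ[y](t) - ∫_a^t ∂₂L_Δ[y](τ) Δτ`. -/
def deltaTerm (T : Set ℝ) (a : ℝ) (LΔ : ℝ → ℝ → ℝ → ℝ) (y : ℝ → ℝ) (t : ℝ) : ℝ :=
  alongDelta T (partial3 LΔ) y t - deltaIntegral T (alongDelta T (partial2 LΔ) y) a t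

/-- `∂₃L_∇{y}(t) - ∫_a^t ∂₂L_∇{y}(τ) ∇τ`. -/
def nablaTerm (T : Set ℝ) (a : ℝ) (Lnabla : ℝ → ℝ → ℝ → ℝ) (y : ℝ → ℝ) (t : ℝ) : ℝ :=
  alongNabla T (partial3 Lnabla) y t - nablaIntegral T (alongNabla T (partial2 Lnabla) y) a t

/-- The delta-nabla Euler-Lagrange equation on `T_κ` (first form). -/
def EulerLagrange1 (T : Set ℝ) (a γ₁ γ₂ : ℝ) (LΔ Lnabla : ℝ → ℝ → ℝ → ℝ) (y : ℝ → ℝ) : Prop :=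
  ∃ c : ℝ, ∀ t ∈ lowerKappa T,
    γ₁ * deltaTerm T a LΔ y (rho T t) + γ₂ * nablaTerm T a Lnabla y t = c

/-- The delta-nabla Euler-Lagrange equation on `T^κ` (second form). -/
def EulerLagrange2 (T : Set ℝ) (a γ₁ γ₂ : ℝ) (LΔ Lnabla : ℝ → ℝ → ℝ → ℝ) (y : ℝ → ℝ) : Prop :=
  ∃ c : ℝ, ∀ t ∈ upperKappa T,
    γ₁ * deltaTerm T a LΔ y t + γ₂ * nablaTerm T a Lnabla y (sigma T t) = c

/-- `z` is a global minimizer of the functional among the admissible functions. -/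
def IsGlobalMinimizer (T : Set ℝ) (a b α β γ₁ γ₂ : ℝ) (LΔ Lnabla : ℝ → ℝ → ℝ → ℝ)
    (z : ℝ → ℝ) : Prop :=
  Admissible T a b α β z ∧ ∀ y : ℝ → ℝ, Admissible T a b α β y →
    functional T a b γ₁ γ₂ LΔ Lnabla z ≤ functional T a b γ₁ γ₂ LΔ Lnabla y

/-- `z` is a global maximizer of the functional among the admissible functions. -/
def IsGlobalMaximizer (T : Set ℝ) (a b α β γ₁ γ₂ : ℝ) (LΔ Lnabla : ℝ → ℝ → ℝ → ℝ)
    (z : ℝ → ℝ) : Prop :=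
  Admissible T a b α β z ∧ ∀ y : ℝ → ℝ, Admissible T a b α β y →
    functional T a b γ₁ γ₂ LΔ Lnabla y ≤ functional T a b γ₁ γ₂ LΔ Lnabla z

end TimeScale

end

/-!
Everything is pulled back to Lebesgue measure on `(a, b)`. For `x` in `(a, b)` let `floor T x` and
`ceil T x` be the nearest points of `T` on either side. By definition the delta integral of `F` is
the Lebesgue integral of `F ∘ floor`, and the nabla integral is that of `F ∘ ceil`. Since `T` has
only countably many scattered points, almost every `x` either lies in a gap of `T` or is a point of
`T` dense from both sides; in both cases `σ (floor x) = ceil x`, `ρ (ceil x) = floor x`, and the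
nabla derivative at `ceil x` equals the delta derivative at `floor x`
(`ae_sigma_floor_and_rho_ceil`, `ae_deltaDeriv_floor_eq_nablaDeriv_ceil`). Hence the two
Euler-Lagrange equations both say that the same function of `x` is almost everywhere constant
(`ae_eulerLagrange`), although on `T` itself they are imposed at different pairs of points.

Two facts of calculus on `T` are needed. The fundamental theorem (`setIntegral_deltaDeriv_floor`) is
the classical one with right derivatives, applied to the extension of `y` that is affine on the gaps
of `T`. Integration by parts (`integral_mul_setIntegral_ceil_add`) is Fubini's theorem, because
`ceil x ≤ s` is equivalent to `x ≤ floor s`; read in two ways it serves both the delta part and the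
nabla part.

Integration by parts turns the first variation of the functional at `yhat` in the direction
`y - yhat` into the integral of the Euler-Lagrange expression times the slope of `y - yhat`. As that
expression is a constant and the slope has integral zero, the first variation vanishes, and the
change of the functional is the integral of the Weierstrass excesses of the two Lagrangians
(`functional_sub_eq`). By the gradient inequality these are nonnegative in the convex case and
nonpositive in the concave case.
-/

noncomputable section

open Filter
open scoped ENNReal

namespace TimeScale

variable {T : Set ℝ} {a b : ℝ}

/-! ### Jump operators and nearest points -/

/-- `T` is a closed set with least element `a` and greatest element `b > a`. -/
structure IsCompactTimeScale (T : Set ℝ) (a b : ℝ) : Prop where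
  isClosed : IsClosed T
  isLeast : IsLeast T a
  isGreatest : IsGreatest T b
  lt : a < b

/-- The largest point of `T` that is at most `x` (for `x` at least `min T`). -/
def floor (T : Set ℝ) (x : ℝ) : ℝ := sSup (T ∩ Iic x)

/-- The smallest point of `T` that is at least `x` (for `x` at most `max T`). -/
def ceil (T : Set ℝ) (x : ℝ) : ℝ := sInf (T ∩ Ici x)

namespace IsCompactTimeScale

theorem sInf_eq (h : IsCompactTimeScale T a b) : sInf T = a := h.isLeast.csInf_eq

theorem sSup_eq (h : IsCompactTimeScale T a b) : sSup T = b := h.isGreatest.csSup_eq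

theorem le_of_mem (h : IsCompactTimeScale T a b) {t : ℝ} (ht : t ∈ T) : a ≤ t := h.isLeast.2 ht

theorem ge_of_mem (h : IsCompactTimeScale T a b) {t : ℝ} (ht : t ∈ T) : t ≤ b :=
  h.isGreatest.2 ht

theorem isCompact (h : IsCompactTimeScale T a b) : IsCompact T :=
  isCompact_Icc.of_isClosed_subset h.isClosed fun _ ht => ⟨h.le_of_mem ht, h.ge_of_mem ht⟩

theorem sigma_mem (h : IsCompactTimeScale T a b) (t : ℝ) : sigma T t ∈ T := by
  unfold sigma
  split_ifs with hne
  · have hmem : sInf (T ∩ Ioi t) ∈ closure (T ∩ Ioi t) :=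
      csInf_mem_closure hne ⟨a, fun s hs => h.le_of_mem hs.1⟩
    exact closure_minimal inter_subset_left h.isClosed hmem
  · rw [h.sSup_eq]; exact h.isGreatest.1

theorem rho_mem (h : IsCompactTimeScale T a b) (t : ℝ) : rho T t ∈ T := by
  unfold rho
  split_ifs with hne
  · have hmem : sSup (T ∩ Iio t) ∈ closure (T ∩ Iio t) :=
      csSup_mem_closure hne ⟨b, fun s hs => h.ge_of_mem hs.1⟩
    exact closure_minimal inter_subset_left h.isClosed hmem
  · rw [h.sInf_eq]; exact h.isLeast.1

theorem sigma_le (h : IsCompactTimeScale T a b) {t s : ℝ} (hs : s ∈ T) (hts : t < s) :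
    sigma T t ≤ s := by
  have hne : (T ∩ Ioi t).Nonempty := ⟨s, hs, hts⟩
  rw [sigma, if_pos hne]
  exact csInf_le ⟨a, fun s hs => h.le_of_mem hs.1⟩ ⟨hs, hts⟩

theorem le_rho (h : IsCompactTimeScale T a b) {t s : ℝ} (hs : s ∈ T) (hst : s < t) :
    s ≤ rho T t := by
  have hne : (T ∩ Iio t).Nonempty := ⟨s, hs, hst⟩
  rw [rho, if_pos hne]
  exact le_csSup ⟨b, fun s hs => h.ge_of_mem hs.1⟩ ⟨hs, hst⟩

theorem le_sigma_of_forall (h : IsCompactTimeScale T a b) {t x : ℝ} (htb : t < b)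
    (hx : ∀ s ∈ T, t < s → x ≤ s) : x ≤ sigma T t := by
  have hne : (T ∩ Ioi t).Nonempty := ⟨b, h.isGreatest.1, htb⟩
  rw [sigma, if_pos hne]
  exact le_csInf hne fun s hs => hx s hs.1 hs.2

theorem rho_le_of_forall (h : IsCompactTimeScale T a b) {t x : ℝ} (hat : a < t)
    (hx : ∀ s ∈ T, s < t → s ≤ x) : rho T t ≤ x := by
  have hne : (T ∩ Iio t).Nonempty := ⟨a, h.isLeast.1, hat⟩
  rw [rho, if_pos hne]
  exact csSup_le hne fun s hs => hx s hs.1 hs.2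

theorem le_sigma (h : IsCompactTimeScale T a b) {t : ℝ} (htb : t < b) : t ≤ sigma T t :=
  h.le_sigma_of_forall htb fun _ _ hs => hs.le

theorem rho_le (h : IsCompactTimeScale T a b) {t : ℝ} (hat : a < t) : rho T t ≤ t :=
  h.rho_le_of_forall hat fun _ _ hs => hs.le

theorem exists_lt_of_sigma_lt (h : IsCompactTimeScale T a b) {t x : ℝ} (htb : t < b)
    (hx : sigma T t < x) : ∃ s ∈ T, t < s ∧ s < x := by
  by_contra! hcon
  exact hx.not_ge (h.le_sigma_of_forall htb hcon)

theorem exists_gt_of_lt_rho (h : IsCompactTimeScale T a b) {t x : ℝ} (hat : a < t)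
    (hx : x < rho T t) : ∃ s ∈ T, s < t ∧ x < s := by
  by_contra! hcon
  exact hx.not_ge (h.rho_le_of_forall hat hcon)

theorem sigma_monotone (h : IsCompactTimeScale T a b) : Monotone (sigma T) := by
  intro s t hst
  rcases lt_or_ge s b with hsb | hsb
  · by_cases hne : (T ∩ Ioi t).Nonempty
    · have hsub : T ∩ Ioi t ⊆ T ∩ Ioi s := inter_subset_inter_right T (Ioi_subset_Ioi hst)
      rw [sigma, sigma, if_pos hne, if_pos (hne.mono hsub)]
      exact csInf_le_csInf ⟨a, fun s hs => h.le_of_mem hs.1⟩ hne hsub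
    · have : sigma T t = b := by rw [sigma, if_neg hne, h.sSup_eq]
      rw [this]
      exact h.ge_of_mem (h.sigma_mem s)
  · have : sigma T t = b := by
      rw [sigma, if_neg, h.sSup_eq]
      rintro ⟨x, hx, hxt⟩
      exact absurd (h.ge_of_mem hx) (not_le.2 ((hsb.trans hst).trans_lt hxt))
    rw [this]
    exact h.ge_of_mem (h.sigma_mem s)

theorem rho_monotone (h : IsCompactTimeScale T a b) : Monotone (rho T) := by
  intro s t hst
  by_cases hne : (T ∩ Iio s).Nonempty
  · have hsub : T ∩ Iio s ⊆ T ∩ Iio t := inter_subset_inter_right T (Iio_subset_Iio hst)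
    rw [rho, rho, if_pos hne, if_pos (hne.mono hsub)]
    exact csSup_le_csSup ⟨b, fun s hs => h.ge_of_mem hs.1⟩ hne hsub
  · have : rho T s = a := by rw [rho, if_neg hne, h.sInf_eq]
    rw [this]
    exact h.le_of_mem (h.rho_mem t)

theorem upperKappa_eq (h : IsCompactTimeScale T a b) : upperKappa T = T ∩ Iic (rho T b) := by
  ext t
  simp only [upperKappa, h.sSup_eq, Set.mem_sdiff, mem_Ioc, mem_inter_iff, mem_Iic, not_and, not_le]
  refine and_congr_right fun ht => ⟨fun hlt => ?_, fun hle hlt => absurd hle hlt.not_ge⟩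
  by_contra! hcon
  exact (hlt hcon).not_ge (h.ge_of_mem ht)

theorem lowerKappa_eq (h : IsCompactTimeScale T a b) : lowerKappa T = T ∩ Ici (sigma T a) := by
  ext t
  simp only [lowerKappa, h.sInf_eq, Set.mem_sdiff, mem_Ico, mem_inter_iff, mem_Ici, not_and, not_lt]
  exact and_congr_right fun ht => ⟨fun hle => hle (h.le_of_mem ht), fun hle _ => hle⟩

theorem isCompact_upperKappa (h : IsCompactTimeScale T a b) : IsCompact (upperKappa T) := by
  rw [h.upperKappa_eq]; exact h.isCompact.inter_right isClosed_Iic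

theorem isCompact_lowerKappa (h : IsCompactTimeScale T a b) : IsCompact (lowerKappa T) := by
  rw [h.lowerKappa_eq]; exact h.isCompact.inter_right isClosed_Ici

theorem mem_upperKappa (h : IsCompactTimeScale T a b) {t : ℝ} (ht : t ∈ T) (htb : t < b) :
    t ∈ upperKappa T := by
  rw [h.upperKappa_eq]; exact ⟨ht, h.le_rho ht htb⟩

theorem mem_lowerKappa (h : IsCompactTimeScale T a b) {t : ℝ} (ht : t ∈ T) (hat : a < t) :
    t ∈ lowerKappa T := by
  rw [h.lowerKappa_eq]; exact ⟨ht, h.sigma_le ht hat⟩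

theorem floor_mem (h : IsCompactTimeScale T a b) {x : ℝ} (hx : a ≤ x) : floor T x ∈ T :=
  ((h.isClosed.inter isClosed_Iic).csSup_mem ⟨a, h.isLeast.1, hx⟩ ⟨x, fun _ hs => hs.2⟩).1

theorem floor_le (h : IsCompactTimeScale T a b) {x : ℝ} (hx : a ≤ x) : floor T x ≤ x :=
  ((h.isClosed.inter isClosed_Iic).csSup_mem ⟨a, h.isLeast.1, hx⟩ ⟨x, fun _ hs => hs.2⟩).2

theorem ceil_mem (h : IsCompactTimeScale T a b) {x : ℝ} (hx : x ≤ b) : ceil T x ∈ T :=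
  ((h.isClosed.inter isClosed_Ici).csInf_mem ⟨b, h.isGreatest.1, hx⟩ ⟨x, fun _ hs => hs.2⟩).1

theorem le_ceil (h : IsCompactTimeScale T a b) {x : ℝ} (hx : x ≤ b) : x ≤ ceil T x :=
  ((h.isClosed.inter isClosed_Ici).csInf_mem ⟨b, h.isGreatest.1, hx⟩ ⟨x, fun _ hs => hs.2⟩).2

end IsCompactTimeScale

theorem le_floor {s x : ℝ} (hs : s ∈ T) (hsx : s ≤ x) : s ≤ floor T x :=
  le_csSup ⟨x, fun _ ht => ht.2⟩ ⟨hs, hsx⟩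

theorem ceil_le {s x : ℝ} (hs : s ∈ T) (hxs : x ≤ s) : ceil T x ≤ s :=
  csInf_le ⟨x, fun _ ht => ht.2⟩ ⟨hs, hxs⟩

namespace IsCompactTimeScale

theorem floor_of_mem (h : IsCompactTimeScale T a b) {t : ℝ} (ht : t ∈ T) : floor T t = t :=
  (h.floor_le (h.le_of_mem ht)).antisymm (le_floor ht le_rfl)

theorem ceil_of_mem (h : IsCompactTimeScale T a b) {t : ℝ} (ht : t ∈ T) : ceil T t = t :=
  (ceil_le ht le_rfl).antisymm (h.le_ceil (h.ge_of_mem ht))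

/-- `ceil` and `floor` form a Galois connection between the points of `[a, b]`. -/
theorem ceil_le_iff_le_floor (h : IsCompactTimeScale T a b) {x s : ℝ} (hx : x ≤ b) (hs : a ≤ s) :
    ceil T x ≤ s ↔ x ≤ floor T s :=
  ⟨fun hle => (h.le_ceil hx).trans (le_floor (h.ceil_mem hx) hle),
    fun hle => (ceil_le (h.floor_mem hs) hle).trans (h.floor_le hs)⟩

theorem le_sigma_floor (h : IsCompactTimeScale T a b) {x : ℝ} (hax : a ≤ x) (hxb : x < b) :
    x ≤ sigma T (floor T x) := by
  refine h.le_sigma_of_forall ((h.floor_le hax).trans_lt hxb) fun s hs hlt => ?_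
  by_contra! hcon
  exact hlt.not_ge (le_floor hs hcon.le)

theorem rho_ceil_le (h : IsCompactTimeScale T a b) {x : ℝ} (hax : a < x) (hxb : x ≤ b) :
    rho T (ceil T x) ≤ x := by
  refine h.rho_le_of_forall (hax.trans_le (h.le_ceil hxb)) fun s hs hlt => ?_
  by_contra! hcon
  exact hlt.not_ge (ceil_le hs hcon.le)

/-- `floor` is constant on `[t, σ(t))`. -/
theorem floor_eq_of_mem_Ico (h : IsCompactTimeScale T a b) {t x : ℝ} (ht : t ∈ T)
    (hx : x ∈ Ico t (sigma T t)) : floor T x = t := by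
  refine le_antisymm ?_ (le_floor ht hx.1)
  by_contra! hcon
  have hax := (h.le_of_mem ht).trans hx.1
  exact (h.sigma_le (h.floor_mem hax) hcon).not_gt ((h.floor_le hax).trans_lt hx.2)

theorem measurable_floor (h : IsCompactTimeScale T a b) : Measurable (floor T) := by
  have hmono : Monotone fun x => floor T (max x a) := fun x y hxy =>
    le_floor (h.floor_mem (le_max_right x a))
      ((h.floor_le (le_max_right x a)).trans (max_le_max_right a hxy))
  have heq : floor T = fun x => if x < a then sSup (∅ : Set ℝ) else floor T (max x a) := by
    ext x
    split_ifs with hx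
    · rw [floor]
      congr 1
      exact eq_empty_of_forall_notMem fun s hs => (h.le_of_mem hs.1).not_gt (hs.2.trans_lt hx)
    · rw [max_eq_left (not_lt.1 hx)]
  rw [heq]
  exact Measurable.ite measurableSet_Iio measurable_const hmono.measurable

theorem measurable_ceil (h : IsCompactTimeScale T a b) : Measurable (ceil T) := by
  have hmono : Monotone fun x => ceil T (min x b) := fun x y hxy =>
    ceil_le (h.ceil_mem (min_le_right y b))
      ((min_le_min_right b hxy).trans (h.le_ceil (min_le_right y b)))
  have heq : ceil T = fun x => if b < x then sInf (∅ : Set ℝ) else ceil T (min x b) := by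
    ext x
    split_ifs with hx
    · rw [ceil]
      congr 1
      exact eq_empty_of_forall_notMem fun s hs => (h.ge_of_mem hs.1).not_gt (hx.trans_le hs.2)
    · rw [min_eq_left (not_lt.1 hx)]
  rw [heq]
  exact Measurable.ite measurableSet_Ioi measurable_const hmono.measurable

/-! ### Almost every point is two-sided dense or lies in a gap -/

theorem countable_rightScattered (h : IsCompactTimeScale T a b) :
    {t ∈ T | t < sigma T t}.Countable := by
  refine (countable_setOfPred_isolated_right_within (s := T)).mono ?_
  rintro t ⟨htT, ht⟩
  refine ⟨htT, ?_⟩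
  have hdisj : (T ∩ Ioi t) ∩ Iio (sigma T t) = ∅ :=
    eq_empty_of_forall_notMem fun s hs => (h.sigma_le hs.1.1 hs.1.2).not_gt hs.2
  rw [← empty_mem_iff_bot, ← hdisj]
  exact inter_mem self_mem_nhdsWithin (mem_nhdsWithin_of_mem_nhds (Iio_mem_nhds ht))

theorem countable_leftScattered (h : IsCompactTimeScale T a b) :
    {t ∈ T | rho T t < t}.Countable := by
  refine (countable_setOfPred_isolated_left_within (s := T)).mono ?_
  rintro t ⟨htT, ht⟩
  refine ⟨htT, ?_⟩
  have hdisj : (T ∩ Iio t) ∩ Ioi (rho T t) = ∅ :=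
    eq_empty_of_forall_notMem fun s hs => (h.le_rho hs.1.1 hs.1.2).not_gt hs.2
  rw [← empty_mem_iff_bot, ← hdisj]
  exact inter_mem self_mem_nhdsWithin (mem_nhdsWithin_of_mem_nhds (Ioi_mem_nhds ht))

/-- Off a countable set, a point of `T` is dense from both sides. -/
theorem ae_dense (h : IsCompactTimeScale T a b) :
    ∀ᵐ x ∂(volume.restrict (Ioo a b)), x ∈ Ioo a b ∧ (x ∈ T → sigma T x = x ∧ rho T x = x) := by
  have h1 := ae_restrict_of_ae (s := Ioo a b) (h.countable_rightScattered.ae_notMem volume)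
  have h2 := ae_restrict_of_ae (s := Ioo a b) (h.countable_leftScattered.ae_notMem volume)
  filter_upwards [h1, h2, ae_restrict_mem measurableSet_Ioo] with x hx1 hx2 hx
  refine ⟨hx, fun hxT => ⟨?_, ?_⟩⟩
  · exact (not_lt.1 fun hlt => hx1 ⟨hxT, hlt⟩).antisymm (h.le_sigma hx.2)
  · exact (h.rho_le hx.1).antisymm (not_lt.1 fun hlt => hx2 ⟨hxT, hlt⟩)

theorem floor_lt_of_notMem (h : IsCompactTimeScale T a b) {x : ℝ} (hax : a ≤ x) (hx : x ∉ T) :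
    floor T x < x :=
  (h.floor_le hax).lt_of_ne fun heq => hx (heq ▸ h.floor_mem hax)

theorem lt_ceil_of_notMem (h : IsCompactTimeScale T a b) {x : ℝ} (hxb : x ≤ b) (hx : x ∉ T) :
    x < ceil T x :=
  (h.le_ceil hxb).lt_of_ne fun heq => hx (heq ▸ h.ceil_mem hxb)

theorem sigma_floor_of_notMem (h : IsCompactTimeScale T a b) {x : ℝ} (hx : x ∈ Ioo a b)
    (hxT : x ∉ T) : sigma T (floor T x) = ceil T x :=
  (h.sigma_le (h.ceil_mem hx.2.le) ((h.floor_le hx.1.le).trans_lt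
    (h.lt_ceil_of_notMem hx.2.le hxT))).antisymm
    (ceil_le (h.sigma_mem _) (h.le_sigma_floor hx.1.le hx.2))

theorem rho_ceil_of_notMem (h : IsCompactTimeScale T a b) {x : ℝ} (hx : x ∈ Ioo a b)
    (hxT : x ∉ T) : rho T (ceil T x) = floor T x :=
  (le_floor (h.rho_mem _) (h.rho_ceil_le hx.1 hx.2.le)).antisymm
    (h.le_rho (h.floor_mem hx.1.le) ((h.floor_lt_of_notMem hx.1.le hxT).trans_le
      (h.le_ceil hx.2.le)))

theorem ae_sigma_floor_and_rho_ceil (h : IsCompactTimeScale T a b) :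
    ∀ᵐ x ∂(volume.restrict (Ioo a b)),
      sigma T (floor T x) = ceil T x ∧ rho T (ceil T x) = floor T x := by
  filter_upwards [h.ae_dense] with x hx
  by_cases hxT : x ∈ T
  · rw [h.floor_of_mem hxT, h.ceil_of_mem hxT]
    exact hx.2 hxT
  · exact ⟨h.sigma_floor_of_notMem hx.1 hxT, h.rho_ceil_of_notMem hx.1 hxT⟩

end IsCompactTimeScale

/-! ### Delta and nabla derivatives -/

theorem eq_zero_of_forall_abs_le_mul {x y : ℝ} (hxy : ∀ ε > 0, |x| ≤ ε * |y|) : x = 0 := by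
  by_contra hx
  have hpos := abs_pos.2 hx
  rcases eq_or_ne y 0 with rfl | hy
  · have := hxy 1 one_pos
    simp only [abs_zero, mul_zero] at this
    linarith
  · have hy' := abs_pos.2 hy
    have := hxy (|x| / (2 * |y|)) (by positivity)
    have heq : |x| / (2 * |y|) * |y| = |x| / 2 := by field_simp
    linarith

theorem hasDeltaDerivAt_deltaDeriv {f : ℝ → ℝ} {t : ℝ} (hf : ∃ d, HasDeltaDerivAt T f d t) :
    HasDeltaDerivAt T f (deltaDeriv T f t) t := by
  rw [deltaDeriv, dif_pos hf]; exact hf.choose_spec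

theorem hasNablaDerivAt_nablaDeriv {f : ℝ → ℝ} {t : ℝ} (hf : ∃ d, HasNablaDerivAt T f d t) :
    HasNablaDerivAt T f (nablaDeriv T f t) t := by
  rw [nablaDeriv, dif_pos hf]; exact hf.choose_spec

theorem HasDeltaDerivAt.sigma_sub_eq {f : ℝ → ℝ} {d t : ℝ} (hf : HasDeltaDerivAt T f d t)
    (ht : t ∈ T) : f (sigma T t) - f t = d * (sigma T t - t) := by
  refine sub_eq_zero.1 (eq_zero_of_forall_abs_le_mul (y := sigma T t - t) fun ε hε => ?_)
  obtain ⟨U, hU, hUs⟩ := hf ε hε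
  exact hUs t ⟨mem_of_mem_nhds hU, ht⟩

theorem HasNablaDerivAt.rho_sub_eq {f : ℝ → ℝ} {d t : ℝ} (hf : HasNablaDerivAt T f d t)
    (ht : t ∈ T) : f (rho T t) - f t = d * (rho T t - t) := by
  refine sub_eq_zero.1 (eq_zero_of_forall_abs_le_mul (y := rho T t - t) fun ε hε => ?_)
  obtain ⟨U, hU, hUs⟩ := hf ε hε
  exact hUs t ⟨mem_of_mem_nhds hU, ht⟩

theorem HasDeltaDerivAt.eventually_abs_sub_le {f : ℝ → ℝ} {d t : ℝ}
    (hf : HasDeltaDerivAt T f d t) (ht : t ∈ T) {ε : ℝ} (hε : 0 < ε) :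
    ∀ᶠ s in 𝓝[T] t, |f s - f t - d * (s - t)| ≤ ε * |sigma T t - s| := by
  obtain ⟨U, hU, hUs⟩ := hf ε hε
  filter_upwards [self_mem_nhdsWithin, mem_nhdsWithin_of_mem_nhds hU] with s hsT hsU
  have hs := hUs s ⟨hsU, hsT⟩
  rw [← abs_neg]
  convert hs using 2
  linarith [hf.sigma_sub_eq ht]

theorem HasDeltaDerivAt.continuousWithinAt {f : ℝ → ℝ} {d t : ℝ} (hf : HasDeltaDerivAt T f d t)
    (ht : t ∈ T) : ContinuousWithinAt f T t := by
  rw [ContinuousWithinAt, tendsto_iff_norm_sub_tendsto_zero]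
  refine squeeze_zero' (g := fun s => |f s - f t - d * (s - t)| + |d| * |s - t|)
    (.of_forall fun _ => norm_nonneg _) (.of_forall fun s => ?_) ?_
  · rw [← abs_mul, Real.norm_eq_abs]
    simpa using abs_add_le (f s - f t - d * (s - t)) (d * (s - t))
  have hid : Tendsto (fun s => s) (𝓝[T] t) (𝓝 t) := tendsto_id.mono_left nhdsWithin_le_nhds
  have h2 : Tendsto (fun s => |d| * |s - t|) (𝓝[T] t) (𝓝 0) := by
    have := ((hid.sub_const t).abs).const_mul |d|
    simpa using this
  have h1 : Tendsto (fun s => |f s - f t - d * (s - t)|) (𝓝[T] t) (𝓝 0) := by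
    rw [Metric.tendsto_nhds]
    intro ε hε
    set M := |sigma T t - t| + 1 with hM
    have hMpos : 0 < M := by positivity
    have hbd : ∀ᶠ s in 𝓝[T] t, |sigma T t - s| < M := by
      have := (hid.const_sub (sigma T t)).abs
      exact this.eventually_lt_const (by linarith)
    filter_upwards [hf.eventually_abs_sub_le ht (div_pos hε hMpos), hbd] with s hs hsM
    rw [Real.dist_eq, sub_zero, abs_abs]
    calc _ ≤ ε / M * |sigma T t - s| := hs
      _ < ε / M * M := by gcongr
      _ = ε := by field_simp
  simpa using h1.add h2

namespace IsCompactTimeScale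

theorem continuousOn_of_isC1Diamond (h : IsCompactTimeScale T a b) {y : ℝ → ℝ}
    (hy : IsC1Diamond T y) : ContinuousOn y T := by
  intro t ht
  by_cases htk : t ∈ upperKappa T
  · exact (hasDeltaDerivAt_deltaDeriv (hy.delta_differentiable t htk)).continuousWithinAt ht
  -- A point of `T` outside `T^κ` is the left-scattered maximum, which is isolated in `T`.
  have htb : t = b := by
    by_contra hne
    exact htk (h.mem_upperKappa ht ((h.ge_of_mem ht).lt_of_ne hne))
  subst htb
  have hlt : rho T t < t := by
    by_contra! hcon
    exact htk (by rw [h.upperKappa_eq]; exact ⟨ht, hcon⟩)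
  have hev : y =ᶠ[𝓝[T] t] fun _ => y t := by
    filter_upwards [self_mem_nhdsWithin, mem_nhdsWithin_of_mem_nhds (Ioi_mem_nhds hlt)]
      with s hs hs'
    rw [(h.ge_of_mem hs).antisymm (not_lt.1 fun hst => (h.le_rho hs hst).not_gt hs')]
  exact continuousWithinAt_const.congr_of_eventuallyEq hev rfl

/-- For almost every `x`, the delta derivative at the left end of the gap around `x` equals the
nabla derivative at the right end; both ends are `x` itself if `x` is in `T`. -/
theorem ae_deltaDeriv_floor_eq_nablaDeriv_ceil (h : IsCompactTimeScale T a b) {y : ℝ → ℝ}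
    (hy : IsC1Diamond T y) : ∀ᵐ x ∂(volume.restrict (Ioo a b)),
      nablaDeriv T y (ceil T x) = deltaDeriv T y (floor T x) := by
  filter_upwards [h.ae_dense] with x ⟨hx, hd⟩
  have hlT := h.floor_mem hx.1.le
  have huT := h.ceil_mem hx.2.le
  have hΔ := hasDeltaDerivAt_deltaDeriv (hy.delta_differentiable _
    (h.mem_upperKappa hlT ((h.floor_le hx.1.le).trans_lt hx.2)))
  have hN := hasNablaDerivAt_nablaDeriv (hy.nabla_differentiable _
    (h.mem_lowerKappa huT (hx.1.trans_le (h.le_ceil hx.2.le))))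
  by_cases hxT : x ∈ T
  · -- Both are limits of the same difference quotients along points of `T` right of `x`.
    rw [h.floor_of_mem hxT] at hΔ ⊢
    rw [h.ceil_of_mem hxT] at hN ⊢
    obtain ⟨hσ, hρ⟩ := hd hxT
    refine sub_eq_zero.1 (eq_zero_of_forall_abs_le_mul (y := 2) fun ε hε => ?_)
    obtain ⟨U, hU, hUs⟩ := hΔ ε hε
    obtain ⟨V, hV, hVs⟩ := hN ε hε
    obtain ⟨δ, hδ, hball⟩ := Metric.mem_nhds_iff.1 (inter_mem hU hV)
    obtain ⟨s, hsT, hxs, hsδ⟩ := h.exists_lt_of_sigma_lt (x := x + δ) hx.2 (by linarith)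
    have hs : s ∈ U ∩ V := hball (by
      rw [Metric.mem_ball, Real.dist_eq, abs_of_pos (by linarith)]; linarith)
    have h1 := hUs s ⟨hs.1, hsT⟩
    have h2 := hVs s ⟨hs.2, hsT⟩
    rw [hσ] at h1
    rw [hρ] at h2
    have hpos : 0 < |x - s| := abs_pos.2 (by linarith)
    refine le_of_mul_le_mul_right ?_ hpos
    rw [← abs_mul]
    calc |(nablaDeriv T y x - deltaDeriv T y x) * (x - s)|
        = |(y x - y s - deltaDeriv T y x * (x - s)) -
            (y x - y s - nablaDeriv T y x * (x - s))| := by congr 1; ring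
      _ ≤ ε * |x - s| + ε * |x - s| := (abs_sub _ _).trans (add_le_add h1 h2)
      _ = ε * |2| * |x - s| := by rw [abs_two]; ring
  · have e1 := hΔ.sigma_sub_eq hlT
    have e2 := hN.rho_sub_eq huT
    rw [h.sigma_floor_of_notMem hx hxT] at e1
    rw [h.rho_ceil_of_notMem hx hxT] at e2
    have hlt : 0 < ceil T x - floor T x := by
      linarith [h.floor_lt_of_notMem hx.1.le hxT, h.lt_ceil_of_notMem hx.2.le hxT]
    refine mul_right_cancel₀ hlt.ne' ?_
    linarith

end IsCompactTimeScale

/-! ### The fundamental theorem of calculus -/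

/-- The extension of a function on `T` to `[a, b]` that is affine on every gap, with slope the
delta derivative at the left end of the gap. -/
def affineExtension (T : Set ℝ) (y : ℝ → ℝ) (x : ℝ) : ℝ :=
  y (floor T x) + deltaDeriv T y (floor T x) * (x - floor T x)

namespace IsCompactTimeScale

theorem affineExtension_of_mem (h : IsCompactTimeScale T a b) (y : ℝ → ℝ) {t : ℝ} (ht : t ∈ T) :
    affineExtension T y t = y t := by
  simp [affineExtension, h.floor_of_mem ht]

theorem affineExtension_of_mem_Icc (h : IsCompactTimeScale T a b) {y : ℝ → ℝ} {t x : ℝ}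
    (ht : t ∈ T) (hy : HasDeltaDerivAt T y (deltaDeriv T y t) t)
    (hx : x ∈ Icc t (sigma T t)) :
    affineExtension T y x = y t + deltaDeriv T y t * (x - t) := by
  rcases hx.2.lt_or_eq with hlt | rfl
  · rw [affineExtension, h.floor_eq_of_mem_Ico ht ⟨hx.1, hlt⟩]
  · rw [h.affineExtension_of_mem y (h.sigma_mem t)]
    linarith [hy.sigma_sub_eq ht]

theorem hasDerivWithinAt_affineExtension (h : IsCompactTimeScale T a b) {y : ℝ → ℝ}
    (hy : IsC1Diamond T y) {x : ℝ} (hx : x ∈ Ico a b) :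
    HasDerivWithinAt (affineExtension T y) (deltaDeriv T y (floor T x)) (Ioi x) x := by
  have hlT := h.floor_mem hx.1
  have hlk := h.mem_upperKappa hlT ((h.floor_le hx.1).trans_lt hx.2)
  have hΔ := hasDeltaDerivAt_deltaDeriv (hy.delta_differentiable _ hlk)
  rcases lt_or_ge x (sigma T (floor T x)) with hgap | hdense
  · have haff : HasDerivWithinAt
        (fun z => y (floor T x) + deltaDeriv T y (floor T x) * (z - floor T x))
        (deltaDeriv T y (floor T x)) (Ioi x) x := by
      simpa using ((((hasDerivAt_id x).sub_const (floor T x)).const_mul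
        (deltaDeriv T y (floor T x))).const_add (y (floor T x))).hasDerivWithinAt (s := Ioi x)
    refine haff.congr_of_eventuallyEq ?_ rfl
    filter_upwards [self_mem_nhdsWithin, mem_nhdsWithin_of_mem_nhds (Iio_mem_nhds hgap)]
      with z hz hz'
    exact h.affineExtension_of_mem_Icc hlT hΔ ⟨(h.floor_le hx.1).trans (le_of_lt hz), hz'.le⟩
  -- Otherwise `x` is a right-dense point of `T`.
  have hσl : sigma T (floor T x) = floor T x :=
    (le_floor (h.sigma_mem _) hdense).antisymm (h.le_sigma ((h.floor_le hx.1).trans_lt hx.2))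
  have hfx : floor T x = x := (h.floor_le hx.1).antisymm (hσl ▸ h.le_sigma_floor hx.1 hx.2)
  rw [hfx] at hlT hlk hΔ hσl ⊢
  have hfloor : Tendsto (floor T) (𝓝[>] x) (𝓝[upperKappa T] x) := by
    refine tendsto_nhdsWithin_iff.2 ⟨?_, ?_⟩
    · refine tendsto_of_tendsto_of_tendsto_of_le_of_le' tendsto_const_nhds
        (tendsto_id.mono_left nhdsWithin_le_nhds) ?_ ?_
      · filter_upwards [self_mem_nhdsWithin] with z hz using le_floor hlT (le_of_lt hz)
      · filter_upwards [self_mem_nhdsWithin] with z hz using h.floor_le (hx.1.trans (le_of_lt hz))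
    · filter_upwards [self_mem_nhdsWithin, mem_nhdsWithin_of_mem_nhds (Iio_mem_nhds hx.2)]
        with z hz hzb
      have haz := hx.1.trans (le_of_lt hz)
      exact h.mem_upperKappa (h.floor_mem haz) ((h.floor_le haz).trans_lt hzb)
  have hsub : upperKappa T ⊆ T := fun _ ht => ht.1
  rw [hasDerivWithinAt_iff_isLittleO, Asymptotics.isLittleO_iff]
  intro ε hε
  have h1 := (hfloor.mono_right (nhdsWithin_mono x hsub)).eventually
    (hΔ.eventually_abs_sub_le hlT hε)
  have h2 : ∀ᶠ z in 𝓝[>] x, |deltaDeriv T y (floor T z) - deltaDeriv T y x| < ε := by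
    have := ((hy.delta_continuous x hlk).tendsto.comp hfloor).eventually
      (Metric.ball_mem_nhds _ hε)
    simpa [Real.dist_eq] using this
  filter_upwards [h1, h2, self_mem_nhdsWithin] with z hz1 hz2 hz
  have hxz : x < z := hz
  have hfz : floor T z ≤ z := h.floor_le (hx.1.trans hxz.le)
  have hxf : x ≤ floor T z := le_floor hlT hxz.le
  rw [hσl, abs_of_nonpos (sub_nonpos.2 hxf)] at hz1
  rw [h.affineExtension_of_mem y hlT, affineExtension, Real.norm_eq_abs, Real.norm_eq_abs,
    abs_of_pos (sub_pos.2 hxz), smul_eq_mul]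
  calc |y (floor T z) + deltaDeriv T y (floor T z) * (z - floor T z) - y x -
          (z - x) * deltaDeriv T y x|
      = |(y (floor T z) - y x - deltaDeriv T y x * (floor T z - x)) +
          (deltaDeriv T y (floor T z) - deltaDeriv T y x) * (z - floor T z)| := by
        congr 1; ring
    _ ≤ ε * -(x - floor T z) + ε * (z - floor T z) := by
        refine (abs_add_le _ _).trans (add_le_add hz1 ?_)
        rw [abs_mul, abs_of_nonneg (sub_nonneg.2 hfz)]
        gcongr
    _ = ε * (z - x) := by ring

theorem continuousWithinAt_Iio_affineExtension (h : IsCompactTimeScale T a b) {y : ℝ → ℝ}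
    (hy : IsC1Diamond T y) {x : ℝ} (hx : x ∈ Ioc a b) :
    ContinuousWithinAt (affineExtension T y) (Iio x) x := by
  rcases (h.rho_le hx.1).lt_or_eq with hlt | heq
  · -- Just left of `x` the extension is affine.
    have hmT := h.rho_mem x
    have hΔ := hasDeltaDerivAt_deltaDeriv (hy.delta_differentiable _
      (h.mem_upperKappa hmT (hlt.trans_le hx.2)))
    have hxσ : x ≤ sigma T (rho T x) := by
      refine h.le_sigma_of_forall (hlt.trans_le hx.2) fun s hs hs' => ?_
      by_contra! hcon
      exact hs'.not_ge (h.le_rho hs hcon)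
    have haff : ContinuousWithinAt
        (fun z => y (rho T x) + deltaDeriv T y (rho T x) * (z - rho T x)) (Iio x) x := by
      fun_prop
    refine haff.congr_of_eventuallyEq ?_ (h.affineExtension_of_mem_Icc hmT hΔ ⟨hlt.le, hxσ⟩)
    filter_upwards [self_mem_nhdsWithin, mem_nhdsWithin_of_mem_nhds (Ioi_mem_nhds hlt)]
      with z hz hz'
    exact h.affineExtension_of_mem_Icc hmT hΔ ⟨le_of_lt hz', (le_of_lt hz).trans hxσ⟩
  -- Otherwise `x` is a left-dense point of `T`.
  have hxT : x ∈ T := heq ▸ h.rho_mem x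
  have hxk : x ∈ upperKappa T := by
    rw [h.upperKappa_eq]
    exact ⟨hxT, show x ≤ _ from heq ▸ h.rho_monotone hx.2⟩
  have hlow : ∀ᶠ z in 𝓝[<] x, a < z := mem_nhdsWithin_of_mem_nhds (Ioi_mem_nhds hx.1)
  have hfloor' : Tendsto (floor T) (𝓝[<] x) (𝓝 x) := by
    refine tendsto_order.2 ⟨fun c hc => ?_, fun c hc => ?_⟩
    · obtain ⟨s, hsT, hsx, hcs⟩ := h.exists_gt_of_lt_rho (x := c) hx.1 (by rwa [heq])
      filter_upwards [mem_nhdsWithin_of_mem_nhds (Ioi_mem_nhds hsx)] with z hz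
      exact hcs.trans_le (le_floor hsT (le_of_lt hz))
    · filter_upwards [self_mem_nhdsWithin, hlow] with z hz haz
      exact (h.floor_le haz.le).trans_lt (lt_trans hz hc)
  have hfloor : Tendsto (floor T) (𝓝[<] x) (𝓝[upperKappa T] x) := by
    refine tendsto_nhdsWithin_iff.2 ⟨hfloor', ?_⟩
    filter_upwards [self_mem_nhdsWithin, hlow] with z hz haz
    exact h.mem_upperKappa (h.floor_mem haz.le)
      ((h.floor_le haz.le).trans_lt (lt_of_lt_of_le hz hx.2))
  have hsub : upperKappa T ⊆ T := fun _ ht => ht.1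
  have h1 := ((h.continuousOn_of_isC1Diamond hy) x hxT).tendsto.comp
    (hfloor.mono_right (nhdsWithin_mono x hsub))
  have h2 := (hy.delta_continuous x hxk).tendsto.comp hfloor
  have hid : Tendsto (fun z : ℝ => z) (𝓝[<] x) (𝓝 x) := tendsto_id.mono_left nhdsWithin_le_nhds
  have h3 := h1.add (h2.mul (hid.sub hfloor'))
  rw [sub_self, mul_zero, add_zero] at h3
  rw [ContinuousWithinAt, h.affineExtension_of_mem y hxT]
  exact h3

theorem continuousOn_affineExtension (h : IsCompactTimeScale T a b) {y : ℝ → ℝ}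
    (hy : IsC1Diamond T y) : ContinuousOn (affineExtension T y) (Icc a b) := by
  intro x hx
  have hsub : Icc a b ⊆ (Icc a b ∩ Iio x) ∪ ({x} ∪ (Icc a b ∩ Ioi x)) := fun z hz => by
    rcases lt_trichotomy z x with h' | h' | h'
    · exact Or.inl ⟨hz, h'⟩
    · exact Or.inr (Or.inl h')
    · exact Or.inr (Or.inr ⟨hz, h'⟩)
  refine ContinuousWithinAt.mono ?_ hsub
  refine ContinuousWithinAt.union ?_ (ContinuousWithinAt.union continuousWithinAt_singleton ?_)
  · rcases hx.1.lt_or_eq with hax | rfl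
    · exact (h.continuousWithinAt_Iio_affineExtension hy ⟨hax, hx.2⟩).mono inter_subset_right
    · have : Icc a b ∩ Iio a = ∅ := eq_empty_of_forall_notMem fun z hz => hz.1.1.not_gt hz.2
      simp [this, ContinuousWithinAt]
  · rcases hx.2.lt_or_eq with hxb | rfl
    · exact (h.hasDerivWithinAt_affineExtension hy ⟨hx.1, hxb⟩).continuousWithinAt.mono
        inter_subset_right
    · have : Icc a x ∩ Ioi x = ∅ := eq_empty_of_forall_notMem fun z hz => hz.1.2.not_gt hz.2
      simp [this, ContinuousWithinAt]

/-- The fundamental theorem of calculus on a time scale, with the delta integral written as a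
Lebesgue integral. -/
theorem setIntegral_deltaDeriv_floor (h : IsCompactTimeScale T a b) {y : ℝ → ℝ}
    (hy : IsC1Diamond T y)
    (hint : Integrable (fun x => deltaDeriv T y (floor T x)) (volume.restrict (Ioo a b)))
    {t : ℝ} (ht : t ∈ T) :
    ∫ x in Iio t, deltaDeriv T y (floor T x) ∂(volume.restrict (Ioo a b)) = y t - y a := by
  have hat := h.le_of_mem ht
  have htb := h.ge_of_mem ht
  have hset : Iio t ∩ Ioo a b = Ioo a t := by
    ext z
    exact ⟨fun hz => ⟨hz.2.1, hz.1⟩, fun hz => ⟨hz.2, hz.1, lt_of_lt_of_le hz.2 htb⟩⟩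
  have hint' : IntegrableOn (fun x => deltaDeriv T y (floor T x)) (Icc a t) := by
    rw [IntegrableOn, ← restrict_Ioo_eq_restrict_Icc]
    exact hint.mono_measure (Measure.restrict_mono (Ioo_subset_Ioo_right htb) le_rfl)
  have hftc := intervalIntegral.integral_eq_sub_of_hasDeriv_right_of_le_real hat
    ((h.continuousOn_affineExtension hy).mono (Icc_subset_Icc_right htb))
    (fun x hx => h.hasDerivWithinAt_affineExtension hy ⟨hx.1.le, hx.2.trans_le htb⟩) hint'
  rw [Measure.restrict_restrict measurableSet_Iio, hset, ← h.affineExtension_of_mem y ht,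
    ← h.affineExtension_of_mem y h.isLeast.1, ← hftc, intervalIntegral.integral_of_le hat,
    integral_Ioc_eq_integral_Ioo]

end IsCompactTimeScale

/-! ### Delta and nabla integrals as Lebesgue integrals -/

/-- A continuous function of `t`, `y (τ t)`, `d t`, where `y` and `d` are continuous on compact
sets carrying `τ t` and the measure, is measurable and bounded although `y ∘ τ` need not be
continuous. -/
theorem memLp_top_of_continuousOn {μ : Measure ℝ} {S : Set ℝ} {K : ℝ → ℝ → ℝ → ℝ}
    {τ y d : ℝ → ℝ} (hT : IsCompact T) (hS : IsCompact S) (hST : S ⊆ T)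
    (hμ : ∀ᵐ t ∂μ, t ∈ S) (hτ : Measurable τ) (hτT : ∀ t, τ t ∈ T) (hy : ContinuousOn y T)
    (hd : ContinuousOn d S)
    (hK : ContinuousOn (fun p : ℝ × ℝ × ℝ => K p.1 p.2.1 p.2.2) (T ×ˢ univ)) :
    MemLp (fun t => K t (y (τ t)) (d t)) ∞ μ := by
  classical
  obtain ⟨My, hMy⟩ := hT.exists_bound_of_continuousOn hy
  obtain ⟨Md, hMd⟩ := hS.exists_bound_of_continuousOn hd
  obtain ⟨C, hC⟩ := (hT.prod ((isCompact_Icc (a := -My) (b := My)).prod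
    (isCompact_Icc (a := -Md) (b := Md)))).exists_bound_of_continuousOn
      (hK.mono (prod_mono le_rfl (subset_univ _)))
  have hmK := hK.measurable_piecewise (g := fun _ => 0) continuousOn_const
    (hT.measurableSet.prod MeasurableSet.univ)
  have hmy := hy.measurable_piecewise (g := fun _ => 0) continuousOn_const hT.measurableSet
  have hmd := hd.measurable_piecewise (g := fun _ => 0) continuousOn_const hS.measurableSet
  have hmeas := hmK.comp (measurable_id.prodMk ((hmy.comp hτ).prodMk hmd))
  refine memLp_top_of_bound (hmeas.aestronglyMeasurable.congr ?_) C ?_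
  · filter_upwards [hμ] with t ht
    simp [piecewise, hST ht, ht, hτT t]
  · filter_upwards [hμ] with t ht
    refine hC (t, y (τ t), d t) ⟨hST ht, ?_, ?_⟩
    · exact abs_le.1 (hMy _ (hτT t))
    · exact abs_le.1 (hMd _ ht)

namespace IsCompactTimeScale

theorem deltaMeasure_eq (h : IsCompactTimeScale T a b) :
    deltaMeasure T = (volume.restrict (Ioo a b)).map (floor T) := by
  rw [restrict_Ioo_eq_restrict_Ico, deltaMeasure, h.sInf_eq, h.sSup_eq]; rfl

theorem nablaMeasure_eq (h : IsCompactTimeScale T a b) :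
    nablaMeasure T = (volume.restrict (Ioo a b)).map (ceil T) := by
  rw [restrict_Ioo_eq_restrict_Ioc, nablaMeasure, h.sInf_eq, h.sSup_eq]; rfl

theorem memLp_alongDelta (h : IsCompactTimeScale T a b) {K : ℝ → ℝ → ℝ → ℝ} {y : ℝ → ℝ}
    (hy : IsC1Diamond T y)
    (hK : ContinuousOn (fun p : ℝ × ℝ × ℝ => K p.1 p.2.1 p.2.2) (T ×ˢ univ)) :
    MemLp (alongDelta T K y) ∞ (deltaMeasure T) := by
  refine memLp_top_of_continuousOn h.isCompact h.isCompact_upperKappa (fun _ ht => ht.1) ?_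
    h.sigma_monotone.measurable h.sigma_mem (h.continuousOn_of_isC1Diamond hy)
    hy.delta_continuous hK
  rw [h.deltaMeasure_eq]
  refine (ae_map_iff (p := fun t => t ∈ upperKappa T) h.measurable_floor.aemeasurable
    h.isCompact_upperKappa.measurableSet).2 ?_
  filter_upwards [ae_restrict_mem measurableSet_Ioo] with x hx
  exact h.mem_upperKappa (h.floor_mem hx.1.le) ((h.floor_le hx.1.le).trans_lt hx.2)

theorem memLp_alongNabla (h : IsCompactTimeScale T a b) {K : ℝ → ℝ → ℝ → ℝ} {y : ℝ → ℝ}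
    (hy : IsC1Diamond T y)
    (hK : ContinuousOn (fun p : ℝ × ℝ × ℝ => K p.1 p.2.1 p.2.2) (T ×ˢ univ)) :
    MemLp (alongNabla T K y) ∞ (nablaMeasure T) := by
  refine memLp_top_of_continuousOn h.isCompact h.isCompact_lowerKappa (fun _ ht => ht.1) ?_
    h.rho_monotone.measurable h.rho_mem (h.continuousOn_of_isC1Diamond hy)
    hy.nabla_continuous hK
  rw [h.nablaMeasure_eq]
  refine (ae_map_iff (p := fun t => t ∈ lowerKappa T) h.measurable_ceil.aemeasurable
    h.isCompact_lowerKappa.measurableSet).2 ?_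
  filter_upwards [ae_restrict_mem measurableSet_Ioo] with x hx
  exact h.mem_lowerKappa (h.ceil_mem hx.2.le) (hx.1.trans_le (h.le_ceil hx.2.le))

theorem memLp_alongDelta_floor (h : IsCompactTimeScale T a b) {K : ℝ → ℝ → ℝ → ℝ} {y : ℝ → ℝ}
    (hy : IsC1Diamond T y)
    (hK : ContinuousOn (fun p : ℝ × ℝ × ℝ => K p.1 p.2.1 p.2.2) (T ×ˢ univ)) :
    MemLp (fun x => alongDelta T K y (floor T x)) ∞ (volume.restrict (Ioo a b)) := by
  have := h.memLp_alongDelta hy hK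
  rw [h.deltaMeasure_eq] at this
  exact this.comp_of_map h.measurable_floor.aemeasurable

theorem memLp_alongNabla_ceil (h : IsCompactTimeScale T a b) {K : ℝ → ℝ → ℝ → ℝ} {y : ℝ → ℝ}
    (hy : IsC1Diamond T y)
    (hK : ContinuousOn (fun p : ℝ × ℝ × ℝ => K p.1 p.2.1 p.2.2) (T ×ˢ univ)) :
    MemLp (fun x => alongNabla T K y (ceil T x)) ∞ (volume.restrict (Ioo a b)) := by
  have := h.memLp_alongNabla hy hK
  rw [h.nablaMeasure_eq] at this
  exact this.comp_of_map h.measurable_ceil.aemeasurable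

theorem memLp_deltaDeriv_floor (h : IsCompactTimeScale T a b) {y : ℝ → ℝ}
    (hy : IsC1Diamond T y) :
    MemLp (fun x => deltaDeriv T y (floor T x)) ∞ (volume.restrict (Ioo a b)) :=
  h.memLp_alongDelta_floor (K := fun _ _ v => v) hy (by fun_prop)

theorem deltaIntegral_eq (h : IsCompactTimeScale T a b) {F : ℝ → ℝ}
    (hF : AEStronglyMeasurable F (deltaMeasure T)) {t : ℝ} (ht : t ∈ T) :
    deltaIntegral T F a t = ∫ x in Iio t, F (floor T x) ∂(volume.restrict (Ioo a b)) := by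
  rw [h.deltaMeasure_eq] at hF
  rw [deltaIntegral, h.deltaMeasure_eq,
    setIntegral_map measurableSet_Ico hF h.measurable_floor.aemeasurable]
  refine setIntegral_congr_set ?_
  filter_upwards [ae_restrict_mem measurableSet_Ioo] with x hx
  refine propext ⟨fun hmem => ?_, fun hlt => ⟨h.le_of_mem (h.floor_mem hx.1.le), ?_⟩⟩
  · exact not_le.1 fun hle => (le_floor ht hle).not_gt hmem.2
  · exact (h.floor_le hx.1.le).trans_lt hlt

theorem nablaIntegral_eq (h : IsCompactTimeScale T a b) {F : ℝ → ℝ}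
    (hF : AEStronglyMeasurable F (nablaMeasure T)) {t : ℝ} (ht : t ∈ T) :
    nablaIntegral T F a t = ∫ x in Iic t, F (ceil T x) ∂(volume.restrict (Ioo a b)) := by
  rw [h.nablaMeasure_eq] at hF
  rw [nablaIntegral, h.nablaMeasure_eq,
    setIntegral_map measurableSet_Ioc hF h.measurable_ceil.aemeasurable]
  refine setIntegral_congr_set ?_
  filter_upwards [ae_restrict_mem measurableSet_Ioo] with x hx
  refine propext ⟨fun hmem => (h.le_ceil hx.2.le).trans hmem.2, fun hle => ⟨?_, ceil_le ht hle⟩⟩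
  exact hx.1.trans_le (h.le_ceil hx.2.le)

end IsCompactTimeScale

theorem restrict_Ioo_restrict_Iio (a b : ℝ) :
    (volume.restrict (Ioo a b)).restrict (Iio b) = volume.restrict (Ioo a b) := by
  rw [Measure.restrict_restrict measurableSet_Iio, inter_eq_right.2 fun x hx => hx.2]

/-! ### Integration by parts -/

namespace IsCompactTimeScale

/-- Integration by parts on a time scale. For `P(t) = ∫_a^t p` and `G(t) = ∫_a^t g`, the integrals
of `p (G ∘ ceil)` and `(P ∘ floor) g` add up to `P(b) G(b)`: by Fubini they are the integrals of
`p(x) g(s)` over `s < ceil x` and over `x ≤ floor s`, and these two regions are complementary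
because `ceil` and `floor` form a Galois connection. -/
theorem integral_mul_setIntegral_ceil_add (h : IsCompactTimeScale T a b) {p g : ℝ → ℝ}
    (hp : Integrable p (volume.restrict (Ioo a b)))
    (hg : Integrable g (volume.restrict (Ioo a b))) :
    Integrable (fun x => p x * ∫ s in Iio (ceil T x), g s ∂(volume.restrict (Ioo a b)))
      (volume.restrict (Ioo a b)) ∧
    Integrable (fun s => (∫ x in Iio (floor T s), p x ∂(volume.restrict (Ioo a b))) * g s)
      (volume.restrict (Ioo a b)) ∧
    (∫ x in Ioo a b, p x * ∫ s in Iio (ceil T x), g s ∂(volume.restrict (Ioo a b))) +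
      (∫ s in Ioo a b, (∫ x in Iio (floor T s), p x ∂(volume.restrict (Ioo a b))) * g s) =
      (∫ x in Ioo a b, p x) * ∫ s in Ioo a b, g s := by
  set μ : Measure ℝ := volume.restrict (Ioo a b) with hμ
  set R : Set (ℝ × ℝ) := {z | z.1 ≤ floor T z.2} with hR
  have hRm : MeasurableSet R :=
    measurableSet_le measurable_fst (h.measurable_floor.comp measurable_snd)
  set Φ : ℝ × ℝ → ℝ := R.indicator fun z => p z.1 * g z.2 with hΦ
  have hΦi : Integrable Φ (μ.prod μ) := (hp.mul_prod hg).indicator hRm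
  have hA : ∀ s, ∫ x, Φ (x, s) ∂μ = (∫ x in Iio (floor T s), p x ∂μ) * g s := by
    intro s
    rw [← integral_Iic_eq_integral_Iio, ← integral_mul_const,
      ← integral_indicator measurableSet_Iic]
    rfl
  have hB : ∀ᵐ x ∂μ, ∫ s, Φ (x, s) ∂μ =
      p x * (∫ s, g s ∂μ) - p x * ∫ s in Iio (ceil T x), g s ∂μ := by
    filter_upwards [ae_restrict_mem measurableSet_Ioo] with x hx
    have hcompl : ∫ s, g s ∂μ - ∫ s in Iio (ceil T x), g s ∂μ = ∫ s in Ici (ceil T x), g s ∂μ := by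
      rw [← integral_add_compl (measurableSet_Iio (a := ceil T x)) hg, compl_Iio]
      ring
    rw [← mul_sub, hcompl, ← integral_const_mul, ← integral_indicator measurableSet_Ici]
    refine integral_congr_ae ?_
    filter_upwards [ae_restrict_mem measurableSet_Ioo] with s hs
    have hiff : (x, s) ∈ R ↔ s ∈ Ici (ceil T x) :=
      (h.ceil_le_iff_le_floor hx.2.le hs.1.le).symm
    by_cases hmem : (x, s) ∈ R
    · rw [hΦ, indicator_of_mem hmem, indicator_of_mem (hiff.1 hmem)]
    · rw [hΦ, indicator_of_notMem hmem, indicator_of_notMem fun h' => hmem (hiff.2 h')]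
  have hAi : Integrable (fun s => (∫ x in Iio (floor T s), p x ∂μ) * g s) μ :=
    hΦi.integral_prod_right.congr (.of_forall hA)
  have hBi : Integrable (fun x => p x * ∫ s in Iio (ceil T x), g s ∂μ) μ := by
    refine ((hp.mul_const (∫ s, g s ∂μ)).sub hΦi.integral_prod_left).congr ?_
    filter_upwards [hB] with x hx
    rw [Pi.sub_apply, hx]
    ring
  refine ⟨hBi, hAi, ?_⟩
  have hswap : ∫ x, ∫ s, Φ (x, s) ∂μ ∂μ = ∫ s, ∫ x, Φ (x, s) ∂μ ∂μ :=
    integral_integral_swap (f := fun x s => Φ (x, s)) hΦi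
  rw [integral_congr_ae hB, integral_congr_ae (.of_forall hA),
    integral_sub (hp.mul_const _) hBi, integral_mul_const] at hswap
  linarith

end IsCompactTimeScale

/-! ### The gradient inequality -/

/-- A convex function on the plane with partial derivatives at a point lies above the affine
function they define there; joint differentiability is not needed. -/
theorem _root_.ConvexOn.add_deriv_mul_add_deriv_mul_le {f : ℝ → ℝ → ℝ}
    (hf : ConvexOn ℝ univ fun p : ℝ × ℝ => f p.1 p.2) {u v : ℝ}
    (hu : DifferentiableAt ℝ (fun x => f x v) u) (hv : DifferentiableAt ℝ (fun x => f u x) v)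
    (u' v' : ℝ) :
    f u v + deriv (fun x => f x v) u * (u' - u) + deriv (fun x => f u x) v * (v' - v) ≤
      f u' v' := by
  set A := deriv (fun x => f x v) u
  set B := deriv (fun x => f u x) v
  set D := f u' v' - f u v with hD
  -- By convexity `ψ ≥ f u v = ψ 0` on `(0, 1)`: the point `(u, v)` is the midpoint of two
  -- points, one towards `(u', v')` and one away from it, and the latter is a midpoint of points
  -- displaced in one coordinate only.
  let ψ : ℝ → ℝ := fun s => s * D +
    (1 / 2 * f (u - 2 * s * (u' - u)) v + 1 / 2 * f u (v - 2 * s * (v' - v)))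
  have hψ0 : ψ 0 = f u v := by simp only [ψ, mul_zero, zero_mul, sub_zero]; ring
  have hlin : ∀ w e : ℝ, HasDerivAt (fun s : ℝ => w - 2 * s * e) (-(2 * e)) 0 := fun w e => by
    simpa using (((hasDerivAt_id (0 : ℝ)).const_mul 2).mul_const e).const_sub w
  have hψ' : HasDerivAt ψ (D - A * (u' - u) - B * (v' - v)) 0 := by
    have h1 : HasDerivAt (fun s : ℝ => f (u - 2 * s * (u' - u)) v) (A * -(2 * (u' - u))) 0 :=
      HasDerivAt.comp (h₂ := fun x => f x v) (0 : ℝ)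
        (by rw [mul_zero, zero_mul, sub_zero]; exact hu.hasDerivAt)
        (hlin u (u' - u))
    have h2 : HasDerivAt (fun s : ℝ => f u (v - 2 * s * (v' - v))) (B * -(2 * (v' - v))) 0 :=
      HasDerivAt.comp (h₂ := fun x => f u x) (0 : ℝ)
        (by rw [mul_zero, zero_mul, sub_zero]; exact hv.hasDerivAt)
        (hlin v (v' - v))
    exact HasDerivAt.congr_deriv (f := ψ) (((hasDerivAt_id (0 : ℝ)).mul_const D).add
      ((h1.const_mul (1 / 2)).add (h2.const_mul (1 / 2)))) (by ring)
  have hnonneg : ∀ s ∈ Ioo (0 : ℝ) 1, f u v ≤ ψ s := by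
    intro s hs
    have c1 := hf.2 (mem_univ (u, v)) (mem_univ (u', v')) (sub_nonneg.2 hs.2.le) hs.1.le
      (sub_add_cancel 1 s)
    have c2 := hf.2 (mem_univ (u - 2 * s * (u' - u), v)) (mem_univ (u, v - 2 * s * (v' - v)))
      one_half_pos.le one_half_pos.le (add_halves (1 : ℝ))
    have c3 := hf.2 (mem_univ (u + s * (u' - u), v + s * (v' - v)))
      (mem_univ (u - s * (u' - u), v - s * (v' - v)))
      one_half_pos.le one_half_pos.le (add_halves (1 : ℝ))
    simp only [Prod.smul_mk, Prod.mk_add_mk, smul_eq_mul] at c1 c2 c3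
    rw [show (1 - s) * u + s * u' = u + s * (u' - u) by ring,
      show (1 - s) * v + s * v' = v + s * (v' - v) by ring] at c1
    rw [show 1 / 2 * (u - 2 * s * (u' - u)) + 1 / 2 * u = u - s * (u' - u) by ring,
      show 1 / 2 * v + 1 / 2 * (v - 2 * s * (v' - v)) = v - s * (v' - v) by ring] at c2
    rw [show 1 / 2 * (u + s * (u' - u)) + 1 / 2 * (u - s * (u' - u)) = u by ring,
      show 1 / 2 * (v + s * (v' - v)) + 1 / 2 * (v - s * (v' - v)) = v by ring] at c3
    simp only [ψ, hD]
    linarith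
  have hlim := hψ'.tendsto_slope.mono_left (nhdsWithin_mono (0 : ℝ)
    (show Ioi (0 : ℝ) ⊆ {0}ᶜ from fun s hs => ne_of_gt hs))
  have hge : 0 ≤ D - A * (u' - u) - B * (v' - v) := by
    refine ge_of_tendsto hlim ?_
    filter_upwards [Ioo_mem_nhdsGT (zero_lt_one' ℝ)] with s hs
    rw [slope_def_field, hψ0, sub_zero]
    exact div_nonneg (sub_nonneg.2 (hnonneg s hs)) hs.1.le
  linarith

theorem _root_.ConcaveOn.le_add_deriv_mul_add_deriv_mul {f : ℝ → ℝ → ℝ}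
    (hf : ConcaveOn ℝ univ fun p : ℝ × ℝ => f p.1 p.2) {u v : ℝ}
    (hu : DifferentiableAt ℝ (fun x => f x v) u) (hv : DifferentiableAt ℝ (fun x => f u x) v)
    (u' v' : ℝ) :
    f u' v' ≤
      f u v + deriv (fun x => f x v) u * (u' - u) + deriv (fun x => f u x) v * (v' - v) := by
  have := ConvexOn.add_deriv_mul_add_deriv_mul_le (f := fun x y => -f x y) hf.neg
    hu.fun_neg hv.fun_neg u' v'
  simp only [deriv.fun_neg] at this
  linarith

/-! ### The variation of the functional -/

/-- Weierstrass excess of `L` at time `t`: the value at `(u', v')` minus that of the first order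
expansion at `(u, v)`. -/
def excess (L : ℝ → ℝ → ℝ → ℝ) (t u v u' v' : ℝ) : ℝ :=
  L t u' v' - (L t u v + partial2 L t u v * (u' - u) + partial3 L t u v * (v' - v))

theorem JointlyConvex.excess_nonneg {L : ℝ → ℝ → ℝ → ℝ} (hL : JointlyConvex T L)
    (hs : IsSmoothLagrangian T L) {t : ℝ} (ht : t ∈ T) (u v u' v' : ℝ) :
    0 ≤ excess L t u v u' v' :=
  sub_nonneg.2 ((hL t ht).add_deriv_mul_add_deriv_mul_le (hs.differentiable2 t ht u v)
    (hs.differentiable3 t ht u v) u' v')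

theorem JointlyConcave.excess_nonpos {L : ℝ → ℝ → ℝ → ℝ} (hL : JointlyConcave T L)
    (hs : IsSmoothLagrangian T L) {t : ℝ} (ht : t ∈ T) (u v u' v' : ℝ) :
    excess L t u v u' v' ≤ 0 :=
  sub_nonpos.2 ((hL t ht).le_add_deriv_mul_add_deriv_mul (hs.differentiable2 t ht u v)
    (hs.differentiable3 t ht u v) u' v')

/-- The slope, at a point of `[a, b]`, of the affine extension of the variation `y - z`. -/
def variationSlope (T : Set ℝ) (z y : ℝ → ℝ) (x : ℝ) : ℝ :=
  deltaDeriv T y (floor T x) - deltaDeriv T z (floor T x)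

/-- The excess of a delta Lagrangian between `z` and `y`, spread over `[a, b]`. -/
def deltaExcess (T : Set ℝ) (L : ℝ → ℝ → ℝ → ℝ) (z y : ℝ → ℝ) (x : ℝ) : ℝ :=
  excess L (floor T x) (z (sigma T (floor T x))) (deltaDeriv T z (floor T x))
    (y (sigma T (floor T x))) (deltaDeriv T y (floor T x))

/-- The excess of a nabla Lagrangian between `z` and `y`, spread over `[a, b]`. -/
def nablaExcess (T : Set ℝ) (L : ℝ → ℝ → ℝ → ℝ) (z y : ℝ → ℝ) (x : ℝ) : ℝ :=
  excess L (ceil T x) (z (rho T (ceil T x))) (nablaDeriv T z (ceil T x))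
    (y (rho T (ceil T x))) (nablaDeriv T y (ceil T x))

namespace IsCompactTimeScale

theorem memLp_variationSlope (h : IsCompactTimeScale T a b) {z y : ℝ → ℝ}
    (hz : IsC1Diamond T z) (hy : IsC1Diamond T y) :
    MemLp (variationSlope T z y) ∞ (volume.restrict (Ioo a b)) :=
  (h.memLp_deltaDeriv_floor hy).sub (h.memLp_deltaDeriv_floor hz)

theorem setIntegral_variationSlope (h : IsCompactTimeScale T a b) {z y : ℝ → ℝ}
    (hz : IsC1Diamond T z) (hy : IsC1Diamond T y) (hya : y a = z a) {t : ℝ} (ht : t ∈ T) :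
    ∫ x in Iio t, variationSlope T z y x ∂(volume.restrict (Ioo a b)) = y t - z t := by
  have hiy := (h.memLp_deltaDeriv_floor hy).integrable le_top
  have hiz := (h.memLp_deltaDeriv_floor hz).integrable le_top
  simp only [variationSlope]
  rw [integral_sub hiy.restrict hiz.restrict, h.setIntegral_deltaDeriv_floor hy hiy ht,
    h.setIntegral_deltaDeriv_floor hz hiz ht, hya]
  ring

theorem integral_variationSlope (h : IsCompactTimeScale T a b) {z y : ℝ → ℝ}
    (hz : IsC1Diamond T z) (hy : IsC1Diamond T y) (hya : y a = z a) (hyb : y b = z b) :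
    ∫ x in Ioo a b, variationSlope T z y x = 0 := by
  have := h.setIntegral_variationSlope hz hy hya h.isGreatest.1
  rwa [restrict_Ioo_restrict_Iio, hyb, sub_self] at this

theorem deltaIntegral_sub_eq (h : IsCompactTimeScale T a b) {L : ℝ → ℝ → ℝ → ℝ} {z y : ℝ → ℝ}
    (hL : IsSmoothLagrangian T L) (hz : IsC1Diamond T z) (hy : IsC1Diamond T y)
    (hya : y a = z a) (hyb : y b = z b) :
    Integrable (fun x => deltaTerm T a L z (floor T x) * variationSlope T z y x)
      (volume.restrict (Ioo a b)) ∧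
    deltaIntegral T (alongDelta T L y) a b - deltaIntegral T (alongDelta T L z) a b =
      (∫ x in Ioo a b, deltaExcess T L z y x) +
        ∫ x in Ioo a b, deltaTerm T a L z (floor T x) * variationSlope T z y x := by
  have hg := h.memLp_variationSlope hz hy
  have hq := h.memLp_alongDelta_floor hz hL.continuous3
  have hqg : Integrable (fun x => alongDelta T (partial3 L) z (floor T x) *
      variationSlope T z y x) (volume.restrict (Ioo a b)) := (hg.mul' hq).integrable le_top
  have hLy := (h.memLp_alongDelta_floor hy hL.continuous).integrable le_top
  have hLz := (h.memLp_alongDelta_floor hz hL.continuous).integrable le_top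
  obtain ⟨hi1, hi2, hibp⟩ := h.integral_mul_setIntegral_ceil_add
    ((h.memLp_alongDelta_floor hz hL.continuous2).integrable le_top) (hg.integrable le_top)
  rw [h.integral_variationSlope hz hy hya hyb, mul_zero] at hibp
  have hterm : (fun x => deltaTerm T a L z (floor T x) * variationSlope T z y x)
      =ᵐ[volume.restrict (Ioo a b)] fun x =>
        alongDelta T (partial3 L) z (floor T x) * variationSlope T z y x -
          (∫ s in Iio (floor T x), alongDelta T (partial2 L) z (floor T s)
            ∂(volume.restrict (Ioo a b))) * variationSlope T z y x := by
    filter_upwards [ae_restrict_mem measurableSet_Ioo] with x hx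
    rw [deltaTerm, h.deltaIntegral_eq
      (h.memLp_alongDelta hz hL.continuous2).aestronglyMeasurable (h.floor_mem hx.1.le), sub_mul]
  have hexc : (fun x => deltaExcess T L z y x) =ᵐ[volume.restrict (Ioo a b)] fun x =>
      alongDelta T L y (floor T x) - (alongDelta T L z (floor T x) +
        alongDelta T (partial2 L) z (floor T x) *
          (∫ s in Iio (ceil T x), variationSlope T z y s ∂(volume.restrict (Ioo a b))) +
        alongDelta T (partial3 L) z (floor T x) * variationSlope T z y x) := by
    filter_upwards [ae_restrict_mem measurableSet_Ioo, h.ae_sigma_floor_and_rho_ceil]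
      with x hx hσ
    rw [h.setIntegral_variationSlope hz hy hya (h.ceil_mem hx.2.le), ← hσ.1]
    rfl
  refine ⟨(hqg.sub hi2).congr hterm.symm, ?_⟩
  rw [integral_congr_ae hterm, integral_congr_ae hexc, integral_sub hqg hi2,
    integral_sub hLy ((hLz.fun_add hi1).fun_add hqg), integral_add (hLz.fun_add hi1) hqg,
    integral_add hLz hi1,
    h.deltaIntegral_eq (h.memLp_alongDelta hy hL.continuous).aestronglyMeasurable h.isGreatest.1,
    h.deltaIntegral_eq (h.memLp_alongDelta hz hL.continuous).aestronglyMeasurable h.isGreatest.1,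
    restrict_Ioo_restrict_Iio]
  linarith

theorem nablaIntegral_sub_eq (h : IsCompactTimeScale T a b) {L : ℝ → ℝ → ℝ → ℝ} {z y : ℝ → ℝ}
    (hL : IsSmoothLagrangian T L) (hz : IsC1Diamond T z) (hy : IsC1Diamond T y)
    (hya : y a = z a) (hyb : y b = z b) :
    Integrable (fun x => nablaTerm T a L z (ceil T x) * variationSlope T z y x)
      (volume.restrict (Ioo a b)) ∧
    nablaIntegral T (alongNabla T L y) a b - nablaIntegral T (alongNabla T L z) a b =
      (∫ x in Ioo a b, nablaExcess T L z y x) +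
        ∫ x in Ioo a b, nablaTerm T a L z (ceil T x) * variationSlope T z y x := by
  have hg := h.memLp_variationSlope hz hy
  have hq := h.memLp_alongNabla_ceil hz hL.continuous3
  have hqg : Integrable (fun x => alongNabla T (partial3 L) z (ceil T x) *
      variationSlope T z y x) (volume.restrict (Ioo a b)) := (hg.mul' hq).integrable le_top
  have hLy := (h.memLp_alongNabla_ceil hy hL.continuous).integrable le_top
  have hLz := (h.memLp_alongNabla_ceil hz hL.continuous).integrable le_top
  -- Compared with the delta case, the variation and the partial derivative exchange roles.
  obtain ⟨hi1, hi2, hibp⟩ := h.integral_mul_setIntegral_ceil_add (hg.integrable le_top)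
    ((h.memLp_alongNabla_ceil hz hL.continuous2).integrable le_top)
  rw [h.integral_variationSlope hz hy hya hyb, zero_mul] at hibp
  have hterm : (fun x => nablaTerm T a L z (ceil T x) * variationSlope T z y x)
      =ᵐ[volume.restrict (Ioo a b)] fun x =>
        alongNabla T (partial3 L) z (ceil T x) * variationSlope T z y x -
          variationSlope T z y x * ∫ s in Iio (ceil T x),
            alongNabla T (partial2 L) z (ceil T s) ∂(volume.restrict (Ioo a b)) := by
    filter_upwards [ae_restrict_mem measurableSet_Ioo] with x hx
    rw [nablaTerm, h.nablaIntegral_eq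
      (h.memLp_alongNabla hz hL.continuous2).aestronglyMeasurable (h.ceil_mem hx.2.le),
      integral_Iic_eq_integral_Iio]
    ring
  have hexc : (fun x => nablaExcess T L z y x) =ᵐ[volume.restrict (Ioo a b)] fun x =>
      alongNabla T L y (ceil T x) - (alongNabla T L z (ceil T x) +
        (∫ s in Iio (floor T x), variationSlope T z y s ∂(volume.restrict (Ioo a b))) *
          alongNabla T (partial2 L) z (ceil T x) +
        alongNabla T (partial3 L) z (ceil T x) * variationSlope T z y x) := by
    filter_upwards [ae_restrict_mem measurableSet_Ioo, h.ae_sigma_floor_and_rho_ceil,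
      h.ae_deltaDeriv_floor_eq_nablaDeriv_ceil hy, h.ae_deltaDeriv_floor_eq_nablaDeriv_ceil hz]
      with x hx hρ hdy hdz
    rw [h.setIntegral_variationSlope hz hy hya (h.floor_mem hx.1.le), variationSlope, ← hdy,
      ← hdz, ← hρ.2, mul_comm (_ - _) (alongNabla T (partial2 L) z (ceil T x))]
    rfl
  refine ⟨(hqg.sub hi1).congr hterm.symm, ?_⟩
  rw [integral_congr_ae hterm, integral_congr_ae hexc, integral_sub hqg hi1,
    integral_sub hLy ((hLz.fun_add hi2).fun_add hqg), integral_add (hLz.fun_add hi2) hqg,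
    integral_add hLz hi2,
    h.nablaIntegral_eq (h.memLp_alongNabla hy hL.continuous).aestronglyMeasurable h.isGreatest.1,
    h.nablaIntegral_eq (h.memLp_alongNabla hz hL.continuous).aestronglyMeasurable h.isGreatest.1,
    integral_Iic_eq_integral_Iio, integral_Iic_eq_integral_Iio, restrict_Ioo_restrict_Iio]
  linarith

/-- At almost every point `x` of `[a, b]`, either of the Euler-Lagrange equations gives the same
relation between the delta term at `floor x` and the nabla term at `ceil x`. -/
theorem ae_eulerLagrange (h : IsCompactTimeScale T a b) {γ₁ γ₂ : ℝ} {LΔ Lnabla : ℝ → ℝ → ℝ → ℝ}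
    {z : ℝ → ℝ}
    (hEL : EulerLagrange1 T a γ₁ γ₂ LΔ Lnabla z ∨ EulerLagrange2 T a γ₁ γ₂ LΔ Lnabla z) :
    ∃ c : ℝ, ∀ᵐ x ∂(volume.restrict (Ioo a b)),
      γ₁ * deltaTerm T a LΔ z (floor T x) + γ₂ * nablaTerm T a Lnabla z (ceil T x) = c := by
  rcases hEL with ⟨c, hc⟩ | ⟨c, hc⟩
  · refine ⟨c, ?_⟩
    filter_upwards [ae_restrict_mem measurableSet_Ioo, h.ae_sigma_floor_and_rho_ceil] with x hx hρ
    rw [← hρ.2]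
    exact hc _ (h.mem_lowerKappa (h.ceil_mem hx.2.le) (hx.1.trans_le (h.le_ceil hx.2.le)))
  · refine ⟨c, ?_⟩
    filter_upwards [ae_restrict_mem measurableSet_Ioo, h.ae_sigma_floor_and_rho_ceil] with x hx hσ
    rw [← hσ.1]
    exact hc _ (h.mem_upperKappa (h.floor_mem hx.1.le) ((h.floor_le hx.1.le).trans_lt hx.2))

/-- Along a solution of the Euler-Lagrange equation the first variation vanishes, so the change of
the functional is the integral of the excess. -/
theorem functional_sub_eq (h : IsCompactTimeScale T a b) {α β γ₁ γ₂ : ℝ}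
    {LΔ Lnabla : ℝ → ℝ → ℝ → ℝ} {z y : ℝ → ℝ} (hLΔ : IsSmoothLagrangian T LΔ)
    (hLnabla : IsSmoothLagrangian T Lnabla) (hz : Admissible T a b α β z)
    (hy : Admissible T a b α β y)
    (hEL : EulerLagrange1 T a γ₁ γ₂ LΔ Lnabla z ∨ EulerLagrange2 T a γ₁ γ₂ LΔ Lnabla z) :
    functional T a b γ₁ γ₂ LΔ Lnabla y - functional T a b γ₁ γ₂ LΔ Lnabla z =
      γ₁ * (∫ x in Ioo a b, deltaExcess T LΔ z y x) +
        γ₂ * ∫ x in Ioo a b, nablaExcess T Lnabla z y x := by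
  have hya : y a = z a := hy.2.1.trans hz.2.1.symm
  have hyb : y b = z b := hy.2.2.trans hz.2.2.symm
  obtain ⟨hi1, h1⟩ := h.deltaIntegral_sub_eq hLΔ hz.1 hy.1 hya hyb
  obtain ⟨hi2, h2⟩ := h.nablaIntegral_sub_eq hLnabla hz.1 hy.1 hya hyb
  obtain ⟨c, hc⟩ := h.ae_eulerLagrange hEL
  have hzero : γ₁ * (∫ x in Ioo a b, deltaTerm T a LΔ z (floor T x) * variationSlope T z y x) +
      γ₂ * ∫ x in Ioo a b, nablaTerm T a Lnabla z (ceil T x) * variationSlope T z y x = 0 := by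
    rw [← integral_const_mul, ← integral_const_mul,
      ← integral_add (hi1.const_mul γ₁) (hi2.const_mul γ₂)]
    calc _ = ∫ x in Ioo a b, c * variationSlope T z y x := by
          refine integral_congr_ae ?_
          filter_upwards [hc] with x hx
          rw [← hx]
          ring
      _ = 0 := by rw [integral_const_mul, h.integral_variationSlope hz.1 hy.1 hya hyb, mul_zero]
  rw [functional, functional]
  linear_combination γ₁ * h1 + γ₂ * h2 + hzero

end IsCompactTimeScale
end TimeScale

end

theorem theorem2 (T : Set ℝ) (a b α β γ₁ γ₂ : ℝ) (LΔ Lnabla : ℝ → ℝ → ℝ → ℝ)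
    (hT : IsClosed T) (ha : IsLeast T a) (hb : IsGreatest T b) (hab : a < b)
    (hTab : (T ∩ Set.Ioo a b).Nonempty)
    (hLΔ : TimeScale.IsSmoothLagrangian T LΔ) (hLnabla : TimeScale.IsSmoothLagrangian T Lnabla)
    (hγ₁ : 0 ≤ γ₁) (hγ₂ : 0 ≤ γ₂) (yhat : ℝ → ℝ)
    (hadm : TimeScale.Admissible T a b α β yhat)
    (hEL : TimeScale.EulerLagrange1 T a γ₁ γ₂ LΔ Lnabla yhat ∨
      TimeScale.EulerLagrange2 T a γ₁ γ₂ LΔ Lnabla yhat) :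
    (TimeScale.JointlyConvex T LΔ → TimeScale.JointlyConvex T Lnabla →
      TimeScale.IsGlobalMinimizer T a b α β γ₁ γ₂ LΔ Lnabla yhat) ∧
    (TimeScale.JointlyConcave T LΔ → TimeScale.JointlyConcave T Lnabla →
      TimeScale.IsGlobalMaximizer T a b α β γ₁ γ₂ LΔ Lnabla yhat) := by
  have h : TimeScale.IsCompactTimeScale T a b := ⟨hT, ha, hb, hab⟩
  refine ⟨fun hcΔ hcN => ⟨hadm, fun y hy => ?_⟩, fun hcΔ hcN => ⟨hadm, fun y hy => ?_⟩⟩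
  · rw [← sub_nonneg, h.functional_sub_eq hLΔ hLnabla hadm hy hEL]
    refine add_nonneg (mul_nonneg hγ₁ (setIntegral_nonneg measurableSet_Ioo fun x hx => ?_))
      (mul_nonneg hγ₂ (setIntegral_nonneg measurableSet_Ioo fun x hx => ?_))
    · exact hcΔ.excess_nonneg hLΔ (h.floor_mem hx.1.le) _ _ _ _
    · exact hcN.excess_nonneg hLnabla (h.ceil_mem hx.2.le) _ _ _ _
  · rw [← sub_nonpos, h.functional_sub_eq hLΔ hLnabla hadm hy hEL]
    refine add_nonpos
      (mul_nonpos_of_nonneg_of_nonpos hγ₁ (setIntegral_nonpos measurableSet_Ioo fun x hx => ?_))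
      (mul_nonpos_of_nonneg_of_nonpos hγ₂ (setIntegral_nonpos measurableSet_Ioo fun x hx => ?_))
    · exact hcΔ.excess_nonpos hLΔ (h.floor_mem hx.1.le) _ _ _ _
    · exact hcN.excess_nonpos hLnabla (h.ceil_mem hx.2.le) _ _ _ _
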